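/- Let $S$ be a scheduling problem on $n$ items, i.e. a boolean formula over atomic formulas $x_i\le x_j$, $i,j\in[n]$. A decision tree is either a leaf, i.e. a (finite, possibly empty) conjunction of inequalities of the form $x_i\le x_j$ or $x_i<x_j$, or an expression "if $\varphi$ then $\psi_t$ else $\psi_f$", where $\varphi$ is such an inequality and $\psi_t,\psi_f$ are decision trees. The cell of a leaf is the conjunction of the leaf with the conditions $\varphi$ (respectively $\neg\varphi$) of its ancestors in whose "then" (respectively "else") branch it lies, and with $0<x_i<1$ for all $i$; it is identified with its solution set in $\mathbb{R}^n$. A set $P\subseteq\mathbb{R}^n$ is almost open if it is the solution set of a finite conjunction of linear inequalities, weak or strict, which are all facet-defining for (the closure of) $P$ and of which at most one is weak. Suppose that $S$ is equivalent to a disjoint union (a disjunction in which, for every $x\in\mathbb{R}^n$, at most one member is true) of finitely many decision trees such that every non-empty cell of each of these trees is almost open. Then: 1. The scheduling quasisymmetric function $\sum_a x_{a_1}\cdots x_{a_n}$, in commuting variables $x_1,x_2,\dots$, where $a$ ranges over all vectors of positive integers that solve $S$, is $L$-positive: it is a linear combination with non-negative integer coefficients of the fundamental quasisymmetric functions $L_\alpha=\sum_{\beta\text{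 refines }\alpha}M_\beta$, where $\alpha,\beta$ are compositions of $n$ and $M_\beta=\sum_{i_1<\dots<i_\ell}x_{i_1}^{\beta_1}\cdots x_{i_\ell}^{\beta_\ell}$. 2. The scheduling polynomial is $h^*$-positive: there is a polynomial $\chi_S$ whose value at every integer $k\ge 0$ is the number of $a\in\{1,\dots,k\}^n$ that solve $S$, and $\chi_S(k)=\sum_{i=0}^n h^*_i\binom{k+n-i}{n}$ for all integers $k\ge 0$ with $h^*_0,\dots,h^*_n\ge 0$. -/

import Mathlib

noncomputable section

namespace Scheduling

open scoped Classical

/-! ### Scheduling problems -/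

/-- A scheduling problem on `n` items: a boolean formula over the atomic formulas `x i ≤ x j`. -/
inductive Problem (n : ℕ) : Type
  | falsum : Problem n
  | atom (i j : Fin n) : Problem n
  | not (S : Problem n) : Problem n
  | and (S T : Problem n) : Problem n
  | or (S T : Problem n) : Problem n

/-- `S.Holds x`: the formula `S` is true for the assignment `x`, with values in any linear order. -/
def Problem.Holds {n : ℕ} {α : Type*} [LinearOrder α] : Problem n → (Fin n → α) → Prop
  | .falsum, _ => False
  | .atom i j, x => x i ≤ x j
  | .not S, x => ¬ S.Holds x
  | .and S T, x => S.Holds x ∧ T.Holds x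
  | .or S T, x => S.Holds x ∨ T.Holds x

/-- The scheduling counting function: the number of `a ∈ [k]^n` that solve `S`. -/
def count {n : ℕ} (S : Problem n) (k : ℕ) : ℕ :=
  Nat.card {a : Fin n → Set.Icc 1 k // S.Holds a}

/-- `p` is the scheduling polynomial of `S`: its value at every `k` is the number of `k`-schedules.
Such a polynomial is unique. -/
def IsSchedulingPolynomial {n : ℕ} (S : Problem n) (p : Polynomial ℚ) : Prop :=
  ∀ k : ℕ, p.eval (k : ℚ) = (count S k : ℚ)

/-- `h` is the `h^*`-vector `(h 0, …, h n)` of the polynomial `p` (with respect to `n`):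
`p(k) = ∑_{i=0}^n h i * binom(k + n - i, n)`. The vector is determined by `p` and `n`. -/
def IsHStarVector (n : ℕ) (p : Polynomial ℚ) (h : Fin (n + 1) → ℚ) : Prop :=
  ∀ k : ℕ, p.eval (k : ℚ) = ∑ i : Fin (n + 1), h i * ((k + n - (i : ℕ)).choose n : ℚ)

/-- `p` is `h^*`-positive: its `h^*`-vector exists and has non-negative entries. -/
def HStarPositive (n : ℕ) (p : Polynomial ℚ) : Prop :=
  ∃ h : Fin (n + 1) → ℚ, IsHStarVector n p h ∧ ∀ i, 0 ≤ h i

/-! ### Quasisymmetric functions in the variables `x_1, x_2, …` -/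

/-- The scheduling quasisymmetric function of `S` in commuting variables,
`∑ x_{a 1} ⋯ x_{a n}` over all vectors `a` of positive integers that solve `S`. The coefficient of
a monomial is the number of solutions `a` that give this monomial. -/
def schedulingQSym {n : ℕ} (S : Problem n) : MvPowerSeries ℕ+ ℤ := fun m =>
  (Nat.card {a : Fin n → ℕ+ // S.Holds a ∧ ∑ i, Finsupp.single (a i) 1 = m} : ℤ)

/-- The monomial quasisymmetric function `M_β = ∑_{f 1 < ⋯ < f l} x_{f 1}^{β_1} ⋯ x_{f l}^{β_l}`. -/
def monomialQSym {n : ℕ} (β : Composition n) : MvPowerSeries ℕ+ ℤ := fun m =>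
  (Nat.card {f : Fin β.length → ℕ+ //
    StrictMono f ∧ ∑ j, Finsupp.single (f j) (β.blocksFun j) = m} : ℤ)

/-- The composition `β` refines the composition `α`: every partial sum of `α` is one of `β`. -/
def Refines {n : ℕ} (β α : Composition n) : Prop :=
  α.boundaries ⊆ β.boundaries

/-- The fundamental quasisymmetric function `L_α = ∑_{β refines α} M_β`. -/
def fundamentalQSym {n : ℕ} (α : Composition n) : MvPowerSeries ℕ+ ℤ :=
  ∑ β : Composition n with Refines β α, monomialQSym β

/-- A quasisymmetric function, homogeneous of degree `n`, is `L`-positive if it is a combination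
of the fundamental quasisymmetric functions with non-negative coefficients. -/
def LPositive (n : ℕ) (F : MvPowerSeries ℕ+ ℤ) : Prop :=
  ∃ c : Composition n → ℤ, (∀ α, 0 ≤ c α) ∧ F = ∑ α, c α • fundamentalQSym α

/-! ### Decision trees and their cells -/

/-- An inequality `x i ≤ x j` (`le i j`) or `x i < x j` (`lt i j`). -/
inductive Ineq (n : ℕ) : Type
  | le (i j : Fin n) : Ineq n
  | lt (i j : Fin n) : Ineq n

/-- Truth of an inequality at a point. -/
def Ineq.Holds {n : ℕ} : Ineq n → (Fin n → ℝ) → Prop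
  | .le i j, x => x i ≤ x j
  | .lt i j, x => x i < x j

/-- The negation of an inequality, again an inequality. -/
def Ineq.neg {n : ℕ} : Ineq n → Ineq n
  | .le i j => .lt j i
  | .lt i j => .le j i

/-- A decision tree: a leaf, which is a conjunction of inequalities (given as a list), or
`if φ then t else f` with an inequality `φ` and decision trees `t`, `f`. -/
inductive DecisionTree (n : ℕ) : Type
  | leaf (ψ : List (Ineq n)) : DecisionTree n
  | ite (φ : Ineq n) (t f : DecisionTree n) : DecisionTree n

/-- Truth of a decision tree at a point. -/
def DecisionTree.Holds {n : ℕ} : DecisionTree n → (Fin n → ℝ) → Prop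
  | .leaf ψ, x => ∀ I ∈ ψ, I.Holds x
  | .ite φ t f, x => if φ.Holds x then t.Holds x else f.Holds x

/-- The cells of a decision tree, one for each leaf: the conjunction of the inequalities of the
leaf and of the conditions on the way to it, negated where the way takes the `else` branch. -/
def DecisionTree.cells {n : ℕ} : DecisionTree n → List (List (Ineq n))
  | .leaf ψ => [ψ]
  | .ite φ t f => t.cells.map (fun C => φ :: C) ++ f.cells.map (fun C => φ.neg :: C)

/-- The set of solutions of a conjunction of inequalities in the open unit cube. -/
def cellPolytope {n : ℕ} (C : List (Ineq n)) : Set (Fin n → ℝ) :=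
  {x | (∀ I ∈ C, I.Holds x) ∧ ∀ i, 0 < x i ∧ x i < 1}

/-! ### Almost open sets -/

/-- A linear inequality `∑ i, coeff i * x i ≤ bound` (if `weak`) or
`∑ i, coeff i * x i < bound` (if not `weak`) on real `n`-space. -/
structure LinIneq (n : ℕ) where
  coeff : Fin n → ℝ
  bound : ℝ
  weak : Prop

/-- Truth of a linear inequality at a point. -/
def LinIneq.Holds {n : ℕ} (I : LinIneq n) (x : Fin n → ℝ) : Prop :=
  if I.weak then ∑ i, I.coeff i * x i ≤ I.bound else ∑ i, I.coeff i * x i < I.bound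

/-- The dimension of (the affine span of) a non-empty set. -/
def dim {n : ℕ} (P : Set (Fin n → ℝ)) : ℕ :=
  Module.finrank ℝ (vectorSpan ℝ P)

/-- `I` is facet-defining for the polyhedron `P`: its weak form is valid on `P`, and the points of
the closure of `P` where it is an equality form a facet, that is, a (non-empty) face whose
dimension is one less than that of `P`. -/
def LinIneq.FacetDefining {n : ℕ} (I : LinIneq n) (P : Set (Fin n → ℝ)) : Prop :=
  (∀ x ∈ P, ∑ i, I.coeff i * x i ≤ I.bound) ∧
  (closure P ∩ {x | ∑ i, I.coeff i * x i = I.bound}).Nonempty ∧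
  dim (closure P ∩ {x | ∑ i, I.coeff i * x i = I.bound}) + 1 = dim P

/-- `P` is almost open: it is the solution set of a finite conjunction of inequalities that are
all facet-defining for `P` and of which at most one is weak. -/
def AlmostOpen {n : ℕ} (P : Set (Fin n → ℝ)) : Prop :=
  ∃ (r : ℕ) (I : Fin r → LinIneq n),
    P = {x | ∀ j, (I j).Holds x} ∧
    (∀ j, (I j).FacetDefining P) ∧
    (∀ j j', (I j).weak → (I j').weak → j = j')

end Scheduling

end

/-!
A cell that is almost open is a difference `U \ V` of two convex open sets. If `q` is a point of
`U ∩ V` with distinct coordinates, or of `U` when `U` and `V` are disjoint, then pushing a point `x`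
slightly away from `q` does not change whether `x` lies in the cell. The push removes all ties
between the coordinates of `x`, so whether `x` lies in the cell depends only on the permutation `σ`
that sorts `x` with ties broken by decreasing coordinates of `q`. For a given `σ` these `x` are the
ones for which `x ∘ σ` is weakly increasing, and strictly increasing at each step where `q ∘ σ` does
not decrease: such vectors are counted by the fundamental quasisymmetric function `L_c` of a
composition `c`, and `binom(k + n - length c, n)` of them have entries in `[1, k]`. As the cells of
a tree are disjoint, these contributions add up.
-/

namespace Scheduling

open Finset Filter Topology

variable {n : ℕ}

section Composition

variable (c d : Composition n)

theorem lt_sizeUpTo_iff_index_lt (i : Fin n) (l : ℕ) :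
    (i : ℕ) < c.sizeUpTo l ↔ (c.index i : ℕ) < l := by
  refine ⟨fun h => ?_, fun h => ?_⟩
  · contrapose! h
    exact (c.monotone_sizeUpTo h).trans (c.sizeUpTo_index_le i)
  · exact (c.lt_sizeUpTo_index_succ i).trans_le (c.monotone_sizeUpTo h)

theorem mem_boundaries_iff_exists_sizeUpTo_eq {k : Fin (n + 1)} :
    k ∈ c.boundaries ↔ ∃ l, c.sizeUpTo l = k := by
  simp only [Composition.boundaries, Finset.mem_map, Finset.mem_univ, true_and]
  refine ⟨fun ⟨l, hl⟩ => ⟨l, congrArg Fin.val hl⟩, fun ⟨l, hl⟩ => ?_⟩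
  rcases le_total l c.length with h | h
  · exact ⟨⟨l, Nat.lt_succ_of_le h⟩, Fin.ext hl⟩
  · refine ⟨Fin.last _, Fin.ext ?_⟩
    rw [← hl, c.sizeUpTo_ofLength_le l h]
    exact c.sizeUpTo_length

theorem index_lt_index_iff_exists_mem_boundaries {i j : Fin n} :
    c.index i < c.index j ↔ ∃ k ∈ c.boundaries, (i : ℕ) < k ∧ (k : ℕ) ≤ j := by
  constructor
  · intro h
    exact ⟨⟨c.sizeUpTo (c.index j), Nat.lt_succ_of_le (c.sizeUpTo_le _)⟩,
      (mem_boundaries_iff_exists_sizeUpTo_eq c).2 ⟨_, rfl⟩,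
      (lt_sizeUpTo_iff_index_lt c i _).2 h, c.sizeUpTo_index_le j⟩
  · rintro ⟨k, hk, hik, hkj⟩
    obtain ⟨l, hl⟩ := (mem_boundaries_iff_exists_sizeUpTo_eq c).1 hk
    have hi : (c.index i : ℕ) < l := (lt_sizeUpTo_iff_index_lt c i l).1 (hl ▸ hik)
    have hj : ¬ (c.index j : ℕ) < l := mt (lt_sizeUpTo_iff_index_lt c j l).2 (by omega)
    exact Fin.lt_def.2 (by omega)

theorem monotone_index : Monotone c.index := by
  intro i j hij
  by_contra! h
  obtain ⟨k, -, hjk, hki⟩ := (index_lt_index_iff_exists_mem_boundaries c).1 h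
  exact absurd (hjk.trans_le hki) (not_lt.2 hij)

theorem index_surjective : Function.Surjective c.index := fun l =>
  ⟨c.embedding l ⟨0, c.one_le_blocksFun l⟩, c.index_embedding _ _⟩

theorem refines_iff_index_lt_index :
    Refines d c ↔ ∀ i j, c.index i < c.index j → d.index i < d.index j := by
  simp only [Refines, index_lt_index_iff_exists_mem_boundaries]
  refine ⟨fun h i j ⟨k, hk, hikj⟩ => ⟨k, h hk, hikj⟩, fun h k hk => ?_⟩
  by_cases h0 : (k : ℕ) = 0
  · exact (mem_boundaries_iff_exists_sizeUpTo_eq d).2 ⟨0, by simp [h0]⟩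
  by_cases hn : (k : ℕ) = n
  · exact (mem_boundaries_iff_exists_sizeUpTo_eq d).2 ⟨d.length, by simp [hn]⟩
  obtain ⟨k', hk', hlt, hle⟩ := h ⟨k - 1, by omega⟩ ⟨k, by omega⟩
    ⟨k, hk, Nat.sub_one_lt h0, le_rfl⟩
  have hkk' : k = k' := Fin.ext (by dsimp only at hlt hle; omega)
  exact hkk' ▸ hk'

theorem eq_of_index_lt_index_iff {c d : Composition n}
    (h : ∀ i j, c.index i < c.index j ↔ d.index i < d.index j) : c = d :=
  (compositionEquiv n).injective <| CompositionAsSet.ext <| Finset.Subset.antisymm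
    ((refines_iff_index_lt_index c d).2 fun i j => (h i j).1)
    ((refines_iff_index_lt_index d c).2 fun i j => (h i j).2)

/-- Read `R i j` as: some block ends between `i` and `j`. -/
theorem exists_index_lt_index_iff {R : Fin n → Fin n → Prop} (hirrefl : ∀ i, ¬ R i i)
    (hsplit : ∀ i j k, i ≤ j → j ≤ k → (R i k ↔ R i j ∨ R j k)) :
    ∃ c : Composition n, ∀ i j, c.index i < c.index j ↔ i < j ∧ R i j := by
  classical
  let s : CompositionAsSet n :=
    { boundaries := {k | ∀ i j : Fin n, (i : ℕ) < k → (k : ℕ) ≤ j → R i j}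
      zero_mem := by simp
      getLast_mem := by simp [Fin.is_lt, not_le.2] }
  refine ⟨s.toComposition, fun i j => ?_⟩
  rw [index_lt_index_iff_exists_mem_boundaries, CompositionAsSet.toComposition_boundaries]
  constructor
  · rintro ⟨k, hk, hik, hkj⟩
    exact ⟨Fin.lt_def.2 (hik.trans_le hkj), (Finset.mem_filter.1 hk).2 i j hik hkj⟩
  rintro ⟨hij, hRij⟩
  obtain ⟨k, ⟨hik, hRik⟩, hmin⟩ :=
    wellFounded_lt.has_min {k | i ≤ k ∧ R i k} ⟨j, hij.le, hRij⟩
  have hik' : i < k := hik.lt_of_ne fun h => hirrefl k (h ▸ hRik)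
  refine ⟨k.castSucc, Finset.mem_filter.2 ⟨Finset.mem_univ _, fun i' j' hi' hj' => ?_⟩, hik',
    not_lt.1 (hmin j ⟨hij.le, hRij⟩)⟩
  have hlk : max i i' < k := max_lt hik' hi'
  have hRlk : R (max i i') k := ((hsplit i _ k (le_max_left i i') hlk.le).1 hRik).resolve_left
    fun h => hmin _ ⟨le_max_left i i', h⟩ hlk
  have hRi'k : R i' k := (hsplit i' _ k (le_max_right i i') hlk.le).2 (.inr hRlk)
  exact (hsplit i' k j' (Fin.le_def.2 hi'.le) (Fin.le_def.2 hj')).2 (.inl hRi'k)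

theorem sum_comp_index {M : Type*} [AddCommMonoid M] (f : Fin c.length → M) :
    ∑ i, f (c.index i) = ∑ l, c.blocksFun l • f l := by
  simp [← c.sum_sum_apply_embedding]

end Composition

section Compatible

/-- `b` is compatible with the composition `c`: it is weakly increasing, and strictly increasing
from each block of `c` to the next one. These vectors index the monomials of `L_c`. -/
def Compatible {ω : Type*} [Preorder ω] (c : Composition n) (b : Fin n → ω) : Prop :=
  Monotone b ∧ ∀ i j, c.index i < c.index j → b i < b j

variable {ω : Type*} {c d : Composition n}

theorem compatible_congr {ω' : Type*} [LinearOrder ω] [LinearOrder ω'] {a : Fin n → ω}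
    {b : Fin n → ω'} (h : ∀ i j, a i ≤ a j ↔ b i ≤ b j) : Compatible c a ↔ Compatible c b := by
  simp only [Compatible, Monotone, ← not_le, h]

theorem compatible_comp_index_iff_refines [Preorder ω] {f : Fin d.length → ω}
    (hf : StrictMono f) :
    Compatible c (f ∘ d.index) ↔ Refines d c := by
  rw [refines_iff_index_lt_index, Compatible, and_iff_right (hf.monotone.comp (monotone_index d))]
  simp only [Function.comp_apply, hf.lt_iff_lt]

theorem exists_strictMono_comp_index_eq [LinearOrder ω] {b : Fin n → ω} (hb : Monotone b) :
    ∃ (c : Composition n) (f : Fin c.length → ω), StrictMono f ∧ f ∘ c.index = b := by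
  obtain ⟨c, hc⟩ := exists_index_lt_index_iff (R := fun i j => b i < b j)
    (fun i => lt_irrefl _) fun i j k hij hjk =>
      ⟨fun h => (lt_or_ge (b i) (b j)).imp_right h.trans_le',
        fun h => h.elim (fun h => h.trans_le (hb hjk)) fun h => (hb hij).trans_lt h⟩
  have hlt (i j : Fin n) : c.index i < c.index j ↔ b i < b j :=
    (hc i j).trans (and_iff_right_of_imp hb.reflect_lt)
  let rep := Function.surjInv (index_surjective c)
  have hrep (l : Fin c.length) : c.index (rep l) = l := Function.surjInv_eq _ l
  refine ⟨c, b ∘ rep, fun l l' h => (hlt _ _).1 (by rwa [hrep, hrep]), funext fun i => ?_⟩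
  exact le_antisymm (not_lt.1 fun h => ((hlt _ _).2 h).ne (hrep _).symm)
    (not_lt.1 fun h => ((hlt _ _).2 h).ne (hrep _))

theorem composition_eq_of_comp_index_eq [Preorder ω] {f : Fin c.length → ω}
    {g : Fin d.length → ω} (hf : StrictMono f) (hg : StrictMono g) (h : f ∘ c.index = g ∘ d.index) :
    c = d :=
  eq_of_index_lt_index_iff fun i j => by
    rw [← hf.lt_iff_lt, ← hg.lt_iff_lt]
    exact .of_eq (congrArg₂ (· < ·) (congrFun h i) (congrFun h j))

/-- The blocks of `c` are the maximal intervals on which `r` is strictly decreasing. -/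
theorem exists_compatible_iff_strictMono_toLex {κ ω : Type*} [Preorder κ] [PartialOrder ω]
    (r : Fin n → κ) : ∃ c : Composition n, ∀ b : Fin n → ω,
      Compatible c b ↔ StrictMono fun i => toLex (b i, OrderDual.toDual (r i)) := by
  obtain ⟨c, hc⟩ := exists_index_lt_index_iff
    (R := fun i j => ¬ StrictAntiOn r (Set.Icc i j)) (by simp) fun i j k hij hjk => by
      rw [← not_and_or, not_iff_not, ← Set.Icc_union_Icc_eq_Icc hij hjk]
      exact ⟨fun h => ⟨h.mono Set.subset_union_left, h.mono Set.subset_union_right⟩,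
        fun h => h.1.union h.2 (isGreatest_Icc hij) (isLeast_Icc hjk)⟩
  refine ⟨c, fun b => ?_⟩
  simp only [Compatible, hc, StrictMono, Prod.Lex.toLex_lt_toLex, OrderDual.toDual_lt_toDual]
  constructor
  · rintro ⟨hb, hlt⟩ i j hij
    refine (hb hij.le).lt_or_eq.imp_right fun heq => ⟨heq, ?_⟩
    have hanti : StrictAntiOn r (Set.Icc i j) := by
      by_contra h
      exact (hlt i j ⟨hij, h⟩).ne heq
    exact hanti (Set.left_mem_Icc.2 hij.le) (Set.right_mem_Icc.2 hij.le) hij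
  · intro h
    have hb : Monotone b := monotone_iff_forall_lt.2 fun i j hij =>
      (h hij).elim le_of_lt fun h => h.1.le
    refine ⟨hb, fun i j ⟨hij, hanti⟩ => (hb hij.le).lt_of_ne fun heq => hanti ?_⟩
    intro k hk l hl hkl
    have hkl_eq : b k = b l :=
      (hb hkl.le).antisymm ((hb hl.2).trans (heq.ge.trans (hb hk.1)))
    exact ((h hkl).resolve_left hkl_eq.not_lt).2

end Compatible

section CountingCompatible

section MonotoneSurjective

variable {m : ℕ} {g : Fin n → Fin m}

theorem apply_add_le_of_monotone_of_surjective (hg : Monotone g) (hs : Function.Surjective g)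
    {i j : Fin n} (hij : i ≤ j) : (g j : ℕ) + i ≤ g i + j := by
  have hcard := Finset.card_le_card_of_surjOn (s := Finset.Icc i j) (t := Finset.Icc (g i) (g j)) g
    (by simpa using surjOn_Icc_of_monotone_surjective hg hs hij)
  simp only [Fin.card_Icc] at hcard
  have := Fin.le_def.1 hij
  omega

theorem apply_le_of_monotone_of_surjective (hg : Monotone g) (hs : Function.Surjective g)
    (i : Fin n) : (g i : ℕ) ≤ i := by
  have hcard := Finset.card_le_card_of_surjOn (s := Finset.Iic i) (t := Finset.Iic (g i)) g
    (by simpa using surjOn_Iic_of_monotone_surjective hg hs i)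
  simpa using hcard

theorem add_le_apply_add_of_monotone_of_surjective (hg : Monotone g) (hs : Function.Surjective g)
    (i : Fin n) : (i : ℕ) + m ≤ g i + n := by
  have hcard := Finset.card_le_card_of_surjOn (s := Finset.Ici i) (t := Finset.Ici (g i)) g
    (by simpa using surjOn_Ici_of_monotone_surjective hg hs i)
  simp only [Fin.card_Ici] at hcard
  omega

end MonotoneSurjective

theorem add_le_apply_add_of_strictMono {f : Fin n → ℕ} (hf : StrictMono f) {i j : Fin n}
    (hij : i ≤ j) : f i + j ≤ f j + i := by
  have hcard := Finset.card_le_card_of_injOn (s := Finset.Icc i j) (t := Finset.Icc (f i) (f j)) f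
    (by simpa using hf.monotone.mapsTo_Icc) hf.injective.injOn
  simp only [Fin.card_Icc, Nat.card_Icc] at hcard
  have := hf.monotone hij
  omega

theorem le_apply_of_strictMono {f : Fin n → ℕ} (hf : StrictMono f) (i : Fin n) : (i : ℕ) ≤ f i := by
  have hcard := Finset.card_le_card_of_injOn (s := Finset.Iic i) (t := Finset.Iic (f i)) f
    (by simpa using hf.monotone.mapsTo_Iic) hf.injective.injOn
  simpa using hcard

theorem apply_add_le_of_strictMono {m : ℕ} {f : Fin n → Fin m} (hf : StrictMono f) (i : Fin n) :
    (f i : ℕ) + n ≤ m + i := by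
  have hcard := Finset.card_le_card_of_injOn (s := Finset.Ici i) (t := Finset.Ici (f i)) f
    (by simpa using hf.monotone.mapsTo_Ici) hf.injective.injOn
  simp only [Fin.card_Ici] at hcard
  omega

variable (c : Composition n)

theorem index_le_self (i : Fin n) : (c.index i : ℕ) ≤ i :=
  apply_le_of_monotone_of_surjective (monotone_index c) (index_surjective c) i

theorem compatible_iff_strictMono_add {b : Fin n → ℕ} :
    Compatible c b ↔ StrictMono fun i => b i + (i - c.index i) := by
  have hle := index_le_self c
  constructor
  · rintro ⟨hb, hlt⟩ i j hij
    have hbij := hb hij.le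
    have hltij := hlt i j
    have hstep := apply_add_le_of_monotone_of_surjective (monotone_index c) (index_surjective c)
      hij.le
    have := hle i
    have := hle j
    simp only [Fin.lt_def] at hij hltij ⊢
    omega
  · intro h
    have hgrow {i j : Fin n} (hij : i ≤ j) : b i + c.index j ≤ b j + c.index i := by
      have := add_le_apply_add_of_strictMono h hij
      have := hle i
      have := hle j
      omega
    have hmono := monotone_index c
    refine ⟨fun i j hij => ?_, fun i j hij => ?_⟩
    · have := hgrow hij
      have := Fin.le_def.1 (hmono hij)
      omega
    · have := hgrow (hmono.reflect_lt hij).le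
      have := Fin.lt_def.1 hij
      omega

/-- Adding to a compatible vector the number of preceding steps inside the blocks makes it strictly
increasing; the shift by one turns `[1, k]` into an initial segment of `ℕ`. -/
def compatibleEquiv (k : ℕ) :
    {b : Fin n → Set.Icc 1 k // Compatible c b} ≃ (Fin n ↪o Fin (k + n - c.length)) where
  toFun b := OrderEmbedding.ofStrictMono
    (fun i => ⟨(b.1 i - 1) + (i - c.index i), by
      have := (b.1 i).2
      have := add_le_apply_add_of_monotone_of_surjective (monotone_index c) (index_surjective c) i
      have := index_le_self c i
      have := (c.index i).2
      simp only [Set.mem_Icc] at *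
      omega⟩)
    (fun i j hij => by
      have := (compatible_iff_strictMono_add c).1 b.2 hij
      have := (b.1 i).2.1
      have := (b.1 j).2.1
      simp only [Fin.lt_def] at *
      omega)
  invFun f := ⟨fun i => ⟨f i + 1 - (i - c.index i), by
      have := le_apply_of_strictMono f.strictMono i
      have := apply_add_le_of_strictMono f.strictMono i
      have := c.length_le
      have := (c.index i).2
      simp only [Set.mem_Icc] at *
      omega⟩, by
      change Compatible c fun i => (f i : ℕ) + 1 - (i - c.index i)
      refine (compatible_iff_strictMono_add c).2 fun i j hij => ?_
      have := le_apply_of_strictMono (f := fun i => (f i : ℕ)) f.strictMono i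
      have := le_apply_of_strictMono (f := fun i => (f i : ℕ)) f.strictMono j
      have := Fin.lt_def.1 (f.strictMono hij)
      dsimp only at *
      omega⟩
  left_inv b := by
    ext i
    have := (b.1 i).2.1
    change (b.1 i : ℕ) - 1 + (i - c.index i) + 1 - (i - c.index i) = b.1 i
    omega
  right_inv f := by
    ext i
    have := le_apply_of_strictMono (f := fun i => (f i : ℕ)) f.strictMono i
    change (f i : ℕ) + 1 - (i - c.index i) - 1 + (i - c.index i) = f i
    omega

theorem card_compatible_Icc (k : ℕ) :
    Nat.card {b : Fin n → Set.Icc 1 k // Compatible c b} = (k + n - c.length).choose n := by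
  rw [Nat.card_congr (compatibleEquiv c k),
    Nat.card_congr (Set.powersetCard.ofFinEmbEquiv (n := n) (I := Fin (k + n - c.length))),
    Set.powersetCard.card, Nat.card_fin]

end CountingCompatible

section FundamentalQSym

theorem finite_setOf_sum_single_eq {ι ω : Type*} [Fintype ι] {e : ι → ℕ} (he : ∀ i, e i ≠ 0)
    (m : ω →₀ ℕ) : {b : ι → ω | ∑ i, Finsupp.single (b i) (e i) = m}.Finite := by
  classical
  refine (Set.Finite.pi' fun _ : ι => m.support.finite_toSet).subset ?_
  rintro b rfl i
  rw [Finset.mem_coe, Finsupp.mem_support_iff, Finsupp.finsetSum_apply]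
  exact fun h => he i (by simpa using Finset.sum_eq_zero_iff.1 h i (Finset.mem_univ i))

theorem sum_single_comp_index {ω : Type*} (β : Composition n) (f : Fin β.length → ω) :
    ∑ i, Finsupp.single ((f ∘ β.index) i) 1 = ∑ j, Finsupp.single (f j) (β.blocksFun j) := by
  simp [sum_comp_index β fun l => Finsupp.single (f l) 1]

theorem fundamentalQSym_apply (α : Composition n) (m : ℕ+ →₀ ℕ) :
    fundamentalQSym α m =
      (Nat.card {b : Fin n → ℕ+ // Compatible α b ∧ ∑ i, Finsupp.single (b i) 1 = m} : ℤ) := by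
  classical
  have hsum : fundamentalQSym α m =
      ∑ β : {β : Composition n // Refines β α}, (Nat.card {f : Fin β.1.length → ℕ+ //
        StrictMono f ∧ ∑ j, Finsupp.single (f j) (β.1.blocksFun j) = m} : ℤ) := by
    change MvPowerSeries.coeff m (fundamentalQSym α) = _
    rw [fundamentalQSym, map_sum, ← Finset.sum_subtype_eq_sum_filter]
    exact Finset.sum_congr (by ext; simp) fun _ _ => rfl
  have hfinite (β : Composition n) : Finite {f : Fin β.length → ℕ+ //
      StrictMono f ∧ ∑ j, Finsupp.single (f j) (β.blocksFun j) = m} :=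
    (finite_setOf_sum_single_eq (fun i => Nat.one_le_iff_ne_zero.1 (β.one_le_blocksFun i)) m).subset
      fun _ h => h.2
  rw [hsum, ← Nat.cast_sum, ← Nat.card_sigma]
  congr 1
  refine Nat.card_eq_of_bijective (fun x => ⟨x.2.1 ∘ x.1.1.index,
    (compatible_comp_index_iff_refines x.2.2.1).2 x.1.2,
    (sum_single_comp_index _ _).trans x.2.2.2⟩) ⟨?_, ?_⟩
  · rintro ⟨⟨β, hβ⟩, f, hf, hfm⟩ ⟨⟨γ, hγ⟩, g, hg, hgm⟩ h
    have hcomp : f ∘ β.index = g ∘ γ.index := congrArg Subtype.val h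
    obtain rfl := composition_eq_of_comp_index_eq hf hg hcomp
    obtain rfl := (index_surjective β).injective_comp_right hcomp
    rfl
  · rintro ⟨b, hb, hm⟩
    obtain ⟨β, f, hf, rfl⟩ := exists_strictMono_comp_index_eq hb.1
    exact ⟨⟨⟨β, (compatible_comp_index_iff_refines hf).1 hb⟩, f, hf,
      (sum_single_comp_index _ _).symm.trans hm⟩, rfl⟩

end FundamentalQSym

section BreaksTies

variable {E : Type*} [AddCommGroup E] [Module ℝ E]

/-- Membership in `P` does not change when a point is pushed slightly away from `q`. If the
coordinates of `q` are distinct, the pushed point has distinct coordinates as well. -/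
def BreaksTies (q : E) (P : Set E) : Prop :=
  ∀ x, ∀ᶠ ε : ℝ in 𝓝[>] 0, x ∈ P ↔ x + ε • (x - q) ∈ P

theorem BreaksTies.diff {q : E} {P Q : Set E} (hP : BreaksTies q P) (hQ : BreaksTies q Q) :
    BreaksTies q (P \ Q) := fun x => by
  filter_upwards [hP x, hQ x] with ε hεP hεQ
  exact and_congr hεP (not_congr hεQ)

variable [TopologicalSpace E] [IsTopologicalAddGroup E] [ContinuousSMul ℝ E]

theorem tendsto_add_smul_sub (q x : E) :
    Tendsto (fun ε : ℝ => x + ε • (x - q)) (𝓝[>] 0) (𝓝 x) := by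
  have hcont : Continuous fun ε : ℝ => x + ε • (x - q) := by fun_prop
  simpa using (hcont.tendsto 0).mono_left nhdsWithin_le_nhds

theorem breaksTies_of_isOpen_of_convex {q : E} {U : Set E} (hopen : IsOpen U)
    (hconvex : Convex ℝ U) (hq : q ∈ U) : BreaksTies q U := by
  intro x
  by_cases hx : x ∈ U
  · filter_upwards [tendsto_add_smul_sub q x (hopen.mem_nhds hx)] with ε hε
    exact iff_of_true hx hε
  · filter_upwards [self_mem_nhdsWithin] with ε (hε : 0 < ε)
    refine iff_of_false hx fun hmem => hx ?_
    have hcomb := hconvex.add_smul_sub_mem hmem hq (t := ε / (1 + ε))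
      ⟨by positivity, (div_le_one (by positivity)).2 (by linarith)⟩
    convert hcomb using 1
    match_scalars <;> field_simp <;> ring

end BreaksTies

section SortedBy

/-- The permutation `σ` sorts `a` increasingly, with ties broken by decreasing values of `q`. -/
def SortedBy {κ ω : Type*} [Preorder κ] [Preorder ω] (q : Fin n → κ) (σ : Equiv.Perm (Fin n))
    (a : Fin n → ω) : Prop :=
  StrictMono fun i => toLex (a (σ i), OrderDual.toDual (q (σ i)))

theorem existsUnique_sortedBy {κ ω : Type*} [LinearOrder κ] [LinearOrder ω] {q : Fin n → κ}
    (hq : Function.Injective q) (a : Fin n → ω) : ∃! σ, SortedBy q σ a := by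
  let key : Fin n → ω ×ₗ κᵒᵈ := fun i => toLex (a i, OrderDual.toDual (q i))
  have hkey : Function.Injective key := fun i j h => hq (congrArg (fun p => (ofLex p).2) h)
  refine ⟨Tuple.sort key, (Tuple.monotone_sort key).strictMono_of_injective
    (hkey.comp (Tuple.sort key).injective), fun σ hσ => Equiv.ext fun i => hkey ?_⟩
  have hσ : StrictMono (key ∘ σ) := hσ
  exact congrFun (Tuple.unique_monotone hσ.monotone (Tuple.monotone_sort key)) i

theorem SortedBy.eventually_strictMono {q x : Fin n → ℝ} {σ : Equiv.Perm (Fin n)}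
    (h : SortedBy q σ x) : ∀ᶠ ε : ℝ in 𝓝[>] 0, StrictMono ((x + ε • (x - q)) ∘ σ) := by
  have hlim := tendsto_pi_nhds.1 (tendsto_add_smul_sub q x)
  refine eventually_all.2 fun i => eventually_all.2 fun j => eventually_imp_distrib_left.2 ?_
  intro hij
  rcases Prod.Lex.toLex_lt_toLex.1 (h hij) with hlt | ⟨heq, hlt⟩
  · exact (hlim (σ i)).eventually_lt (hlim (σ j)) hlt
  · filter_upwards [self_mem_nhdsWithin] with ε (hε : 0 < ε)
    have hlt : q (σ j) < q (σ i) := hlt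
    have heq : x (σ i) = x (σ j) := heq
    simp only [Function.comp_apply, Pi.add_apply, Pi.smul_apply, Pi.sub_apply, smul_eq_mul, heq]
    gcongr

theorem exists_mem_injective_of_isOpen {U : Set (Fin n → ℝ)} (hU : IsOpen U) (hne : U.Nonempty) :
    ∃ q ∈ U, Function.Injective q := by
  obtain ⟨x, hx⟩ := hne
  let q : Fin n → ℝ := fun i => (i : ℕ)
  have hq : Function.Injective q := Nat.cast_injective.comp Fin.val_injective
  obtain ⟨σ, hσ, -⟩ := existsUnique_sortedBy hq x
  obtain ⟨ε, hmono, hmem⟩ :=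
    (hσ.eventually_strictMono.and (tendsto_add_smul_sub q x (hU.mem_nhds hx))).exists
  exact ⟨_, hmem, hmono.injective.of_comp_right σ.surjective⟩

end SortedBy

section AlmostOpen

theorem exists_injective_breaksTies_diff {U V : Set (Fin n → ℝ)} (hU : IsOpen U)
    (hUc : Convex ℝ U) (hV : IsOpen V) (hVc : Convex ℝ V) (hne : (U \ V).Nonempty) :
    ∃ q, Function.Injective q ∧ BreaksTies q (U \ V) := by
  by_cases hUV : (U ∩ V).Nonempty
  · obtain ⟨q, ⟨hqU, hqV⟩, hq⟩ := exists_mem_injective_of_isOpen (hU.inter hV) hUV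
    exact ⟨q, hq, (breaksTies_of_isOpen_of_convex hU hUc hqU).diff
      (breaksTies_of_isOpen_of_convex hV hVc hqV)⟩
  · rw [(Set.disjoint_iff_inter_eq_empty.2 (Set.not_nonempty_iff_eq_empty.1 hUV)).sdiff_eq_left]
      at hne ⊢
    obtain ⟨q, hqU, hq⟩ := exists_mem_injective_of_isOpen hU hne
    exact ⟨q, hq, breaksTies_of_isOpen_of_convex hU hUc hqU⟩

theorem AlmostOpen.exists_eq_diff {P : Set (Fin n → ℝ)} (h : AlmostOpen P) :
    ∃ U V, (IsOpen U ∧ Convex ℝ U) ∧ (IsOpen V ∧ Convex ℝ V) ∧ P = U \ V := by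
  obtain ⟨r, I, rfl, -, hweak⟩ := h
  let φ (j : Fin r) (x : Fin n → ℝ) : ℝ := ∑ i, (I j).coeff i * x i
  have hcont (j : Fin r) : Continuous (φ j) := by fun_prop
  have hlin (j : Fin r) : IsLinearMap ℝ (φ j) :=
    (dotProductBilin ℝ ℝ (I j).coeff).isLinear
  refine ⟨{x | ∀ j, ¬ (I j).weak → φ j x < (I j).bound},
    {x | ∃ j, (I j).weak ∧ (I j).bound < φ j x}, ⟨?_, ?_⟩, ⟨?_, ?_⟩, ?_⟩
  · simp only [Set.ofPred_forall]
    exact isOpen_iInter_of_finite fun j => isOpen_iInter_of_finite fun _ =>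
      isOpen_lt (hcont j) continuous_const
  · simp only [Set.ofPred_forall]
    exact convex_iInter₂ fun j _ => convex_halfSpace_lt (hlin j) _
  · simp only [Set.ofPred_exists, Set.ofPred_and]
    exact isOpen_iUnion fun j => isOpen_const.inter (isOpen_lt continuous_const (hcont j))
  · rintro x ⟨j, hj, hx⟩ y ⟨j', hj', hy⟩ s t hs ht hst
    obtain rfl := hweak j j' hj hj'
    exact ⟨j, hj, convex_halfSpace_gt (hlin j) _ hx hy hs ht hst⟩
  · ext x
    simp only [Set.mem_ofPred_eq, Set.mem_sdiff, not_exists, not_and, not_lt, ← forall_and]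
    refine forall_congr' fun j => ?_
    by_cases hj : (I j).weak <;> simp [LinIneq.Holds, hj, φ]

theorem AlmostOpen.exists_injective_breaksTies {P : Set (Fin n → ℝ)} (h : AlmostOpen P)
    (hne : P.Nonempty) : ∃ q, Function.Injective q ∧ BreaksTies q P := by
  obtain ⟨U, V, ⟨hU, hUc⟩, ⟨hV, hVc⟩, rfl⟩ := h.exists_eq_diff
  exact exists_injective_breaksTies_diff hU hUc hV hVc hne

end AlmostOpen

section OrderPattern

theorem le_iff_le_of_strictMono_comp {ι κ ω ω' : Type*} [LinearOrder ι] [Preorder ω] [Preorder ω']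
    {σ : ι ≃ κ} {x : κ → ω} {y : κ → ω'} (hx : StrictMono (x ∘ σ)) (hy : StrictMono (y ∘ σ))
    (i j : κ) : x i ≤ x j ↔ y i ≤ y j := by
  obtain ⟨i, rfl⟩ := σ.surjective i
  obtain ⟨j, rfl⟩ := σ.surjective j
  exact hx.le_iff_le.trans hy.le_iff_le.symm

variable {ω ω' : Type*} [LinearOrder ω] [LinearOrder ω']

theorem Problem.holds_congr (S : Problem n) {a : Fin n → ω} {b : Fin n → ω'}
    (h : ∀ i j, a i ≤ a j ↔ b i ≤ b j) : S.Holds a ↔ S.Holds b := by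
  induction S with
  | falsum => rfl
  | atom i j => exact h i j
  | not S ih => exact not_congr ih
  | and S T ihS ihT => exact and_congr ihS ihT
  | or S T ihS ihT => exact or_congr ihS ihT

theorem Ineq.holds_congr (I : Ineq n) {x y : Fin n → ℝ} (h : ∀ i j, x i ≤ x j ↔ y i ≤ y j) :
    I.Holds x ↔ I.Holds y := by
  cases I with
  | le i j => exact h i j
  | lt i j => simp only [Ineq.Holds, ← not_le, h]

theorem Ineq.neg_holds_iff (I : Ineq n) (x : Fin n → ℝ) : I.neg.Holds x ↔ ¬ I.Holds x := by
  cases I <;> simp [Ineq.neg, Ineq.Holds]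

/-- The open unit cube, which contains all cells. -/
def cube (n : ℕ) : Set (Fin n → ℝ) :=
  {x | ∀ i, 0 < x i ∧ x i < 1}

theorem isOpen_cube : IsOpen (cube n) := by
  simp only [cube, Set.ofPred_forall]
  exact isOpen_iInter_of_finite fun i =>
    (isOpen_lt continuous_const (continuous_apply i)).and
      (isOpen_lt (continuous_apply i) continuous_const)

theorem exists_mem_cube_le_iff_le (a : Fin n → ω) :
    ∃ x ∈ cube n, ∀ i j, x i ≤ x j ↔ a i ≤ a j := by
  have : Nontrivial (Set.Ioo (0 : ℝ) 1) := (Set.Ioo_infinite one_pos).nontrivial.coe_sort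
  obtain ⟨e⟩ := Order.embedding_from_countable_to_dense (Set.range a) (Set.Ioo (0 : ℝ) 1)
  exact ⟨fun i => e ⟨a i, i, rfl⟩, fun i => (e ⟨a i, i, rfl⟩).2, fun i j => e.le_iff_le⟩

end OrderPattern

section Decomposition

/-- On `D`, the set `P` is the disjoint union, over the index type `ι`, of the sets of those `x` for
which `x ∘ σ i` is compatible with `c i`. -/
def IsDecomposition {ι ω : Type*} [Preorder ω] (D P : Set (Fin n → ω))
    (σ : ι → Equiv.Perm (Fin n)) (c : ι → Composition n) : Prop :=
  ∀ x ∈ D, (x ∈ P ↔ ∃ i, Compatible (c i) (x ∘ σ i)) ∧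
    {i | Compatible (c i) (x ∘ σ i)}.Subsingleton

/-- In the open unit cube, `P` is a finite disjoint union of sets of vectors that are, up to a
permutation of the coordinates, compatible with a composition. -/
def IsDecomposable (P : Set (Fin n → ℝ)) : Prop :=
  ∃ (ι : Type) (_ : Finite ι) (σ : ι → Equiv.Perm (Fin n)) (c : ι → Composition n),
    IsDecomposition (cube n) P σ c

theorem IsDecomposable.congr {P Q : Set (Fin n → ℝ)} (hP : IsDecomposable P)
    (h : ∀ x ∈ cube n, x ∈ Q ↔ x ∈ P) : IsDecomposable Q := by
  obtain ⟨ι, hι, σ, c, hdec⟩ := hP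
  exact ⟨ι, hι, σ, c, fun x hx => ⟨(h x hx).trans (hdec x hx).1, (hdec x hx).2⟩⟩

theorem isDecomposable_empty : IsDecomposable (∅ : Set (Fin n → ℝ)) :=
  ⟨Empty, inferInstance, Empty.elim, Empty.elim, fun x _ => ⟨by simp, fun i => i.elim⟩⟩

theorem isDecomposable_iUnion {κ : Type} [Finite κ] {P : κ → Set (Fin n → ℝ)}
    (hP : ∀ k, IsDecomposable (P k)) (hdisjoint : Pairwise (Function.onFun Disjoint P)) :
    IsDecomposable (⋃ k, P k) := by
  choose ι hι σ c hdec using hP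
  refine ⟨Σ k, ι k, inferInstance, fun p => σ p.1 p.2, fun p => c p.1 p.2, fun x hx => ⟨?_, ?_⟩⟩
  · simp only [Set.mem_iUnion, (hdec _ x hx).1, Sigma.exists]
  · rintro ⟨k, i⟩ hi ⟨l, j⟩ hj
    have hk : x ∈ P k := (hdec k x hx).1.2 ⟨i, hi⟩
    have hl : x ∈ P l := (hdec l x hx).1.2 ⟨j, hj⟩
    obtain rfl : k = l := hdisjoint.eq (Set.not_disjoint_iff.2 ⟨x, hk, hl⟩)
    exact congrArg (Sigma.mk k) ((hdec k x hx).2 hi hj)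

theorem mem_cellPolytope_iff_of_sortedBy {C : List (Ineq n)} {q x : Fin n → ℝ}
    {σ : Equiv.Perm (Fin n)} (hC : BreaksTies q (cellPolytope C)) (hx : x ∈ cube n)
    (hσ : SortedBy q σ x) :
    x ∈ cellPolytope C ↔ ∃ y ∈ cellPolytope C, StrictMono (y ∘ σ) := by
  obtain ⟨ε, hiff, hmono, hcube⟩ := ((hC x).and (hσ.eventually_strictMono.and
    (tendsto_add_smul_sub q x (isOpen_cube.mem_nhds hx)))).exists
  rw [hiff]
  refine ⟨fun h => ⟨_, h, hmono⟩, fun ⟨y, hy, hyσ⟩ => ⟨fun I hI => ?_, hcube⟩⟩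
  exact (I.holds_congr (le_iff_le_of_strictMono_comp hmono hyσ)).2 (hy.1 I hI)

theorem isDecomposable_cellPolytope {C : List (Ineq n)} {q : Fin n → ℝ}
    (hq : Function.Injective q) (hC : BreaksTies q (cellPolytope C)) :
    IsDecomposable (cellPolytope C) := by
  choose c hc using fun σ : Equiv.Perm (Fin n) =>
    exists_compatible_iff_strictMono_toLex (ω := ℝ) (q ∘ σ)
  have hsorted (σ x) : Compatible (c σ) (x ∘ σ) ↔ SortedBy q σ x := hc σ (x ∘ σ)
  refine ⟨{σ : Equiv.Perm (Fin n) // ∃ y ∈ cellPolytope C, StrictMono (y ∘ σ)}, inferInstance,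
    Subtype.val, fun σ => c σ, fun x hx => ?_⟩
  obtain ⟨τ, hτ, hunique⟩ := existsUnique_sortedBy hq x
  simp only [hsorted]
  refine ⟨⟨fun hxC => ?_, fun ⟨σ, hσ⟩ => ?_⟩, fun σ hσ σ' hσ' => ?_⟩
  · exact ⟨⟨τ, (mem_cellPolytope_iff_of_sortedBy hC hx hτ).1 hxC⟩, hτ⟩
  · exact (mem_cellPolytope_iff_of_sortedBy hC hx hσ).2 σ.2
  · exact Subtype.ext ((hunique σ hσ).trans (hunique σ' hσ').symm)

end Decomposition

namespace DecisionTree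

theorem holds_iff_exists_mem_cells (T : DecisionTree n) (x : Fin n → ℝ) :
    T.Holds x ↔ ∃ C ∈ T.cells, ∀ I ∈ C, I.Holds x := by
  induction T with
  | leaf ψ => simp [DecisionTree.Holds, cells]
  | ite φ t f iht ihf =>
    by_cases hφ : φ.Holds x <;>
      simp [DecisionTree.Holds, cells, or_and_right, exists_or, Ineq.neg_holds_iff, hφ, iht, ihf]

theorem pairwise_disjoint_cells (T : DecisionTree n) :
    T.cells.Pairwise fun C C' => Disjoint (cellPolytope C) (cellPolytope C') := by
  have hcons {φ : Ineq n} {C : List (Ineq n)} : cellPolytope (φ :: C) ⊆ cellPolytope C :=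
    fun x hx => ⟨fun I hI => hx.1 I (List.mem_cons_of_mem _ hI), hx.2⟩
  induction T with
  | leaf ψ => exact List.pairwise_singleton _ _
  | ite φ t f iht ihf =>
    refine List.pairwise_append.2 ⟨?_, ?_, ?_⟩
    · exact List.pairwise_map.2 (iht.imp fun h => h.mono hcons hcons)
    · exact List.pairwise_map.2 (ihf.imp fun h => h.mono hcons hcons)
    · simp only [List.mem_map]
      rintro - ⟨C, -, rfl⟩ - ⟨C', -, rfl⟩
      refine Set.disjoint_left.2 fun x hx hx' => ?_
      exact (φ.neg_holds_iff x).1 (hx'.1 _ List.mem_cons_self) (hx.1 _ List.mem_cons_self)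

theorem isDecomposable (T : DecisionTree n)
    (h : ∀ C ∈ T.cells, IsDecomposable (cellPolytope C)) :
    IsDecomposable {x | T.Holds x} := by
  have hdisjoint : Pairwise (Function.onFun Disjoint fun i => cellPolytope (T.cells.get i)) :=
    fun i j hij => hij.lt_or_gt.elim (List.pairwise_iff_get.1 T.pairwise_disjoint_cells i j)
      fun hji => (List.pairwise_iff_get.1 T.pairwise_disjoint_cells j i hji).symm
  refine (isDecomposable_iUnion (fun i => h _ (T.cells.get_mem i)) hdisjoint).congr fun x hx => ?_
  have hcell (C : List (Ineq n)) : x ∈ cellPolytope C ↔ ∀ I ∈ C, I.Holds x :=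
    and_iff_left hx
  simp only [Set.mem_ofPred_eq, Set.mem_iUnion, hcell, holds_iff_exists_mem_cells,
    List.exists_mem_iff_get]

end DecisionTree

section Counting

variable {ι : Type*} {σ : ι → Equiv.Perm (Fin n)} {c : ι → Composition n}

theorem IsDecomposition.of_cube {S : Problem n} {ω : Type*} [LinearOrder ω]
    (h : IsDecomposition (cube n) {x | S.Holds x} σ c) :
    IsDecomposition Set.univ {a : Fin n → ω | S.Holds a} σ c := by
  intro a _
  obtain ⟨x, hx, hxa⟩ := exists_mem_cube_le_iff_le a
  have hcompatible (i) : Compatible (c i) (x ∘ σ i) ↔ Compatible (c i) (a ∘ σ i) :=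
    compatible_congr fun j k => hxa (σ i j) (σ i k)
  simpa only [Set.mem_ofPred_eq, S.holds_congr hxa, hcompatible] using h x hx

theorem IsDecomposition.card_eq_sum [Fintype ι] {ω : Type*} [Preorder ω] {P s : Set (Fin n → ω)}
    (h : IsDecomposition Set.univ P σ c) (hs : s.Finite)
    (hperm : ∀ a ∈ s, ∀ τ : Equiv.Perm (Fin n), a ∘ τ ∈ s) :
    Nat.card {a // a ∈ P ∧ a ∈ s} = ∑ i, Nat.card {b // Compatible (c i) b ∧ b ∈ s} := by
  have hfinite (i : ι) : Finite {b // Compatible (c i) b ∧ b ∈ s} := hs.subset fun _ hb => hb.2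
  have hcancel (i : ι) (b : Fin n → ω) : (b ∘ (σ i).symm) ∘ σ i = b := by
    rw [Function.comp_assoc, Equiv.symm_comp_self, Function.comp_id]
  have hmem {i : ι} {b : Fin n → ω} (hb : Compatible (c i) b) :
      Compatible (c i) ((b ∘ (σ i).symm) ∘ σ i) := (hcancel i b).symm ▸ hb
  rw [← Nat.card_sigma]
  refine (Nat.card_eq_of_bijective (fun p : Σ i, {b // Compatible (c i) b ∧ b ∈ s} =>
    ⟨p.2.1 ∘ (σ p.1).symm, (h _ trivial).1.2 ⟨p.1, hmem p.2.2.1⟩, hperm _ p.2.2.2 _⟩)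
    ⟨?_, ?_⟩).symm
  · rintro ⟨i, b, hb, hbs⟩ ⟨j, b', hb', hbs'⟩ heq
    have heq : b ∘ (σ i).symm = b' ∘ (σ j).symm := congrArg Subtype.val heq
    obtain rfl : i = j := (h (b ∘ (σ i).symm) trivial).2 (hmem hb) (heq ▸ hmem hb')
    obtain rfl := (σ i).symm.surjective.injective_comp_right heq
    rfl
  · rintro ⟨a, haP, has⟩
    obtain ⟨i, hi⟩ := (h a trivial).1.1 haP
    refine ⟨⟨i, a ∘ σ i, hi, hperm a has _⟩, Subtype.ext ?_⟩
    exact funext fun j => congrArg a ((σ i).apply_symm_apply j)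

variable {S : Problem n} [Fintype ι]

theorem IsDecomposition.schedulingQSym_eq_sum
    (h : IsDecomposition Set.univ {a : Fin n → ℕ+ | S.Holds a} σ c) :
    schedulingQSym S = ∑ i, fundamentalQSym (c i) := by
  refine MvPowerSeries.ext fun m => ?_
  have hcard := h.card_eq_sum (finite_setOf_sum_single_eq (fun _ => one_ne_zero) m)
    fun a ha τ => (Equiv.sum_comp τ fun i => Finsupp.single (a i) 1).trans ha
  rw [map_sum]
  change (Nat.card _ : ℤ) = ∑ i, fundamentalQSym (c i) m
  simp only [fundamentalQSym_apply, ← Nat.cast_sum]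
  exact congrArg Nat.cast hcard

theorem IsDecomposition.count_eq_sum {k : ℕ}
    (h : IsDecomposition Set.univ {a : Fin n → Set.Icc 1 k | S.Holds a} σ c) :
    count S k = ∑ i, (k + n - (c i).length).choose n := by
  have hcard := h.card_eq_sum Set.finite_univ fun _ _ _ => Set.mem_univ _
  simp only [Set.mem_univ, and_true, card_compatible_Icc] at hcard
  exact hcard

theorem lPositive_sum_fundamentalQSym (c : ι → Composition n) :
    LPositive n (∑ i, fundamentalQSym (c i)) := by
  classical
  refine ⟨fun α => #{i | c i = α}, fun α => Int.natCast_nonneg _, ?_⟩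
  simp only [natCast_zsmul, ← Finset.sum_const, Finset.sum_fiberwise']

theorem exists_polynomial_eval_eq_choose (n r : ℕ) :
    ∃ p : Polynomial ℚ, ∀ k : ℕ, p.eval (k : ℚ) = ((k + r).choose n : ℚ) := by
  refine ⟨Polynomial.C ((n.factorial : ℚ)⁻¹) *
    (descPochhammer ℚ n).comp (Polynomial.X + Polynomial.C (r : ℚ)), fun k => ?_⟩
  rw [Nat.cast_choose_eq_descPochhammer_div]
  simp [div_eq_inv_mul]

theorem exists_hStarPositive_of_count_eq_sum (l : ι → Fin (n + 1))
    (h : ∀ k, count S k = ∑ i, (k + n - l i).choose n) :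
    ∃ p : Polynomial ℚ, IsSchedulingPolynomial S p ∧ HStarPositive n p := by
  classical
  choose b hb using exists_polynomial_eval_eq_choose n
  have hp : IsSchedulingPolynomial S (∑ i, b (n - l i)) := fun k => by
    simp only [h, Polynomial.eval_finsetSum, hb, Nat.cast_sum, Nat.add_sub_assoc (l _).is_le]
  refine ⟨_, hp, fun j => #{i | l i = j}, fun k => ?_, fun j => Nat.cast_nonneg _⟩
  simp only [hp k, h, Nat.cast_sum, ← nsmul_eq_mul, ← Finset.sum_const]
  exact (Finset.sum_fiberwise' _ _ fun j : Fin (n + 1) => ((k + n - j).choose n : ℚ)).symm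

theorem lPositive_and_exists_hStarPositive_of_isDecomposable
    (hS : IsDecomposable {x | S.Holds x}) :
    LPositive n (schedulingQSym S) ∧
      ∃ p : Polynomial ℚ, IsSchedulingPolynomial S p ∧ HStarPositive n p := by
  obtain ⟨ι, hι, σ, c, hdec⟩ := hS
  cases nonempty_fintype ι
  constructor
  · rw [hdec.of_cube.schedulingQSym_eq_sum]
    exact lPositive_sum_fundamentalQSym c
  · exact exists_hStarPositive_of_count_eq_sum
      (fun i => ⟨(c i).length, Nat.lt_succ_of_le (c i).length_le⟩)
      fun k => hdec.of_cube.count_eq_sum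

end Counting

end Scheduling

open Scheduling in
theorem mainTheorem8_general {n : ℕ} (S : Problem n) {m : ℕ} (T : Fin m → DecisionTree n)
    (hunion : ∀ x : Fin n → ℝ, S.Holds x ↔ ∃ i, (T i).Holds x)
    (hdisjoint : ∀ (x : Fin n → ℝ) (i j : Fin m), (T i).Holds x → (T j).Holds x → i = j)
    (hcells : ∀ i, ∀ C ∈ (T i).cells, (cellPolytope C).Nonempty →
      ∃ q, Function.Injective q ∧ BreaksTies q (cellPolytope C)) :
    LPositive n (schedulingQSym S) ∧
      ∃ p : Polynomial ℚ, IsSchedulingPolynomial S p ∧ HStarPositive n p := by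
  have hcell (i) (C) (hC : C ∈ (T i).cells) : IsDecomposable (cellPolytope C) := by
    rcases (cellPolytope C).eq_empty_or_nonempty with hempty | hne
    · exact hempty ▸ isDecomposable_empty
    · obtain ⟨q, hq, hqC⟩ := hcells i C hC hne
      exact isDecomposable_cellPolytope hq hqC
  have hS : {x : Fin n → ℝ | S.Holds x} = ⋃ i, {x | (T i).Holds x} := by
    ext x
    simpa using hunion x
  refine lPositive_and_exists_hStarPositive_of_isDecomposable
    (hS ▸ isDecomposable_iUnion (fun i => (T i).isDecomposable (hcell i)) fun i j hij => ?_)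
  exact Set.disjoint_left.2 fun x hi hj => hij (hdisjoint x i j hi hj)

theorem mainTheorem8 (n : ℕ) (S : Scheduling.Problem n)
    (m : ℕ) (T : Fin m → Scheduling.DecisionTree n)
    (hunion : ∀ x : Fin n → ℝ, S.Holds x ↔ ∃ i, (T i).Holds x)
    (hdisjoint : ∀ (x : Fin n → ℝ) (i j : Fin m), (T i).Holds x → (T j).Holds x → i = j)
    (hcells : ∀ i, ∀ C ∈ (T i).cells, (Scheduling.cellPolytope C).Nonempty →
      Scheduling.AlmostOpen (Scheduling.cellPolytope C)) :
    Scheduling.LPositive n (Scheduling.schedulingQSym S) ∧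
    ∃ p : Polynomial ℚ, Scheduling.IsSchedulingPolynomial S p ∧
      Scheduling.HStarPositive n p :=
  mainTheorem8_general S T hunion hdisjoint fun i C hC hne =>
    (hcells i C hC hne).exists_injective_breaksTies hne
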